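/- Let $k$ be a commutative ring; all algebras are commutative $k$-algebras. A simplicial algebra $\mathbf F$ is called free if there are sets $S_m\subseteq F_{m}$ ($m\ge 1$) of indeterminates, with $d_i b=0$ for all $b\in S_m$ and $i<m$, such that for every $n$ the algebra $F_n$ is the polynomial algebra over $F_0$ (embedded by the iterated degeneracy) on the elements $\theta^*b$, where $m\ge 1$, $b\in S_m$ and $\theta:[n]\to[m]$ is a monotone surjection. The $1$-skeleton of $\mathbf F$ is the value at the $1$-truncation of $\mathbf F$ of the left adjoint of the truncation functor. Let $\mathbf E=\mathbf E^{(1)}$ be the $1$-skeleton of a free simplicial algebra, let $d_i^1:E_1\to E_0$ ($i=0,1$) be its faces, and let $NE_n=\bigcap_{i<n}\operatorname{Ker} d_i^n$ be its Moore complex with $\partial_n$ the restriction of $d_n^n$. Let $E_1$ act on $NE_2/\partial_3NE_3$ through $s_1$, and regard the ideals $\operatorname{Ker}d_0^1$ and $\operatorname{Ker}d_1^1$ of $E_1$ as crossed $E_1$-modules. For crossed $R$-modules $\mu:M\to R$, $\nu:N\to R$, let $M\otimes_R N$ denote the (non-unital) commutative $R$-algebra generated by symbols $m\otimes n$ subject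 to $r(m\otimes n)=rm\otimes n=m\otimes rn$, biadditivity, and $(m\otimes n)(m'\otimes n')=mm'\otimes nn'$; it has the maps $\lambda:M\otimes_R N\to M$, $m\otimes n\mapsto \nu(n)m$, and $\lambda':M\otimes_R N\to N$, $m\otimes n\mapsto\mu(m)n$. For $y\in\operatorname{Ker}d_0^1$ put $\bar y=y-s_0d_1y\in\operatorname{Ker}d_1^1$; the map $y\mapsto\bar y$ is a bijection $\operatorname{Ker}d_0^1\to\operatorname{Ker}d_1^1$. Then there is an isomorphism of $E_1$-algebras $$\operatorname{Ker}d_1^1\otimes_{E_1}\operatorname{Ker}d_0^1\;\cong\; NE_2/\partial_3NE_3$$ under which $\bar y\otimes x$ corresponds to $s_1x(s_1y-s_0y)+\partial_3NE_3$ for all $x,y\in\operatorname{Ker}d_0^1$, and likewise an isomorphism of $E_1$-algebras $\operatorname{Ker}d_0^1\otimes_{E_1}\operatorname{Ker}d_1^1\cong NE_2/\partial_3NE_3$ under which $x\otimes\bar y$ corresponds to $s_1x(s_1y-s_0y)+\partial_3NE_3$. Under both isomorphisms the maps $NE_2/\partial_3NE_3\to\operatorname{Ker}d_0^1$ and $NE_2/\partial_3NE_3\to\operatorname{Ker}d_1^1$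 induced by $d_2$ correspond to the maps $\lambda,\lambda'$ from the tensor product to the respective factors. -/

import Mathlib

open CategoryTheory
open scoped Simplicial TensorProduct

universe u v

noncomputable section

/-! ### Crossed modules of commutative algebras and their tensor product -/

/-- A crossed module `∂ : C → R` of commutative algebras: `C` is a (not necessarily unital)
commutative `R`-algebra, the action of `R` being the scalar multiplication. -/
structure CrossedModule (R C : Type*) [CommRing R] [NonUnitalCommRing C] [Module R C]
    [IsScalarTower R C C] [SMulCommClass R C C] where
  /-- the boundary morphism -/
  bd : C →ₙ+* R
  bd_smul : ∀ (r : R) (c : C), bd (r • c) = r * bd c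
  peiffer : ∀ c c' : C, bd c • c' = c * c'

namespace CrossedModule

/-- An ideal, with its inclusion and the action by multiplication, is a crossed module. -/
def ofIdeal {R : Type*} [CommRing R] (I : Ideal R) : CrossedModule R I where
  bd := { toFun := fun x => (x : R)
          map_mul' := fun _ _ => rfl
          map_zero' := rfl
          map_add' := fun _ _ => rfl }
  bd_smul _ _ := rfl
  peiffer _ _ := rfl

section Tensor

variable {R M N : Type*} [CommRing R]
  [NonUnitalCommRing M] [Module R M] [IsScalarTower R M M] [SMulCommClass R M M]
  [NonUnitalCommRing N] [Module R N] [IsScalarTower R N N] [SMulCommClass R N N]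

/-- The tensor product of two crossed `R`-modules `μ : M → R` and `ν : N → R`: the `R`-algebra
generated by symbols `m ⊗ n`, subject to `r (m ⊗ n) = (r m) ⊗ n = m ⊗ (r n)`, biadditivity and
`(m ⊗ n) (m' ⊗ n') = (m m') ⊗ (n n')`. That this is the algebra with this presentation is
`CrossedModule.tensor_presentation`. -/
abbrev Tensor (_ : CrossedModule R M) (_ : CrossedModule R N) : Type _ := M ⊗[R] N

/-- The morphism `λ : M ⊗ N → M`, `m ⊗ n ↦ ν(n) m`. -/
def tensorFst (X : CrossedModule R M) (Y : CrossedModule R N) : X.Tensor Y →ₗ[R] M :=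
  TensorProduct.lift (LinearMap.mk₂ R (fun m n => Y.bd n • m)
    (fun m m' n => smul_add _ _ _)
    (fun r m n => smul_comm _ _ _)
    (fun m n n' => by rw [map_add, add_smul])
    (fun r m n => by rw [Y.bd_smul, mul_smul]))

/-- The morphism `λ' : M ⊗ N → N`, `m ⊗ n ↦ μ(m) n`. -/
def tensorSnd (X : CrossedModule R M) (Y : CrossedModule R N) : X.Tensor Y →ₗ[R] N :=
  TensorProduct.lift (LinearMap.mk₂ R (fun m n => X.bd m • n)
    (fun m m' n => by rw [map_add, add_smul])
    (fun r m n => by rw [X.bd_smul, mul_smul])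
    (fun m n n' => smul_add _ _ _)
    (fun r m n => smul_comm _ _ _))

/-- The tensor product has the stated presentation: a map `h` on the symbols `m ⊗ n` with values in
a commutative `R`-algebra extends to an algebra morphism, in a unique way, as soon as it respects
the defining relations. -/
theorem tensor_presentation (X : CrossedModule R M) (Y : CrossedModule R N)
    {A : Type*} [NonUnitalCommRing A] [Module R A] [IsScalarTower R A A] [SMulCommClass R A A]
    (h : M → N → A)
    (h_smul_left : ∀ (r : R) m n, h (r • m) n = r • h m n)
    (h_smul_right : ∀ (r : R) m n, h m (r • n) = r • h m n)
    (h_add_left : ∀ m m' n, h (m + m') n = h m n + h m' n)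
    (h_add_right : ∀ m n n', h m (n + n') = h m n + h m n')
    (h_mul : ∀ m m' n n', h m n * h m' n' = h (m * m') (n * n')) :
    ∃! φ : X.Tensor Y →ₙₐ[R] A, ∀ m n, φ (m ⊗ₜ[R] n) = h m n := by
  let f : M ⊗[R] N →ₗ[R] A := TensorProduct.lift
    (LinearMap.mk₂ R h h_add_left h_smul_left h_add_right h_smul_right)
  have hf : ∀ m n, f (m ⊗ₜ[R] n) = h m n := fun m n => by simp [f]
  refine ⟨{ toFun := f, map_smul' := fun r t => map_smul f r t, map_zero' := map_zero f,
            map_add' := map_add f, map_mul' := ?_ }, hf, ?_⟩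
  · intro s t
    induction s using TensorProduct.induction_on with
    | zero => simp
    | add s s' hs hs' => rw [add_mul, map_add, hs, hs', map_add, add_mul]
    | tmul m n =>
      induction t using TensorProduct.induction_on with
      | zero => simp
      | add t t' ht ht' => rw [mul_add, map_add, ht, ht', map_add, mul_add]
      | tmul m' n' => rw [Algebra.TensorProduct.tmul_mul_tmul, hf, hf, hf, h_mul]
  · intro ψ hψ
    ext t
    change ψ t = f t
    induction t using TensorProduct.induction_on with
    | zero => simp
    | add s s' hs hs' => rw [map_add, map_add, hs, hs']
    | tmul m n => rw [hψ, hf]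

end Tensor

end CrossedModule

/-! ### Simplicial commutative algebras -/

/-- Simplicial commutative `k`-algebras. -/
abbrev SimpAlg (k : Type u) [CommRing k] := SimplicialObject (CommAlgCat.{v} k)

namespace SimpAlg

variable {k : Type u} [CommRing k]

/-- The face morphism `d_i : E_{n+1} → E_n`. -/
abbrev d (E : SimpAlg.{u, v} k) {n : ℕ} (i : Fin (n + 2)) : E _⦋n + 1⦌ →ₐ[k] E _⦋n⦌ :=
  (E.δ i).hom

/-- The degeneracy morphism `s_i : E_n → E_{n+1}`. -/
abbrev s (E : SimpAlg.{u, v} k) {n : ℕ} (i : Fin (n + 1)) : E _⦋n⦌ →ₐ[k] E _⦋n + 1⦌ :=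
  (E.σ i).hom

/-! #### Free simplicial algebras and skeletons -/

/-- The degenerate copies in dimension `n` of the indeterminates `S m` of dimension `m + 1`: one for
every indeterminate `b` and every surjective monotone map `⦋n⦌ → ⦋m + 1⦌`. -/
abbrev FreeIndex (F : SimpAlg.{u, v} k) (S : ∀ m : ℕ, Set (F _⦋m + 1⦌)) (n : ℕ) : Type v :=
  Σ m : ℕ, {θ : ⦋n⦌ ⟶ ⦋m + 1⦌ // Epi θ} × S m

/-- The canonical morphism from the polynomial algebra over `F_0` on the degenerate copies of the
indeterminates to `F_n`; the algebra `F_0` maps to `F_n` by the iterated degeneracy. -/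
def freeMap (F : SimpAlg.{u, v} k) (S : ∀ m : ℕ, Set (F _⦋m + 1⦌)) (n : ℕ) :
    MvPolynomial (F.FreeIndex S n) (F _⦋0⦌) →+* F _⦋n⦌ :=
  MvPolynomial.eval₂Hom ((F.map (SimplexCategory.const ⦋n⦌ ⦋0⦌ 0).op).hom : F _⦋0⦌ →+* F _⦋n⦌)
    (fun j => (F.map j.2.1.1.op).hom j.2.2.1)

/-- A simplicial algebra is free (obtained from the constant simplicial algebra on `F_0` by the
step-by-step construction) if there are sets of indeterminates `S m ⊆ F_{m+1}`, all of whose faces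
except the last one vanish, such that every `F_n` is the polynomial algebra over `F_0` on the
degenerate copies of these indeterminates. -/
def IsFree (F : SimpAlg.{u, v} k) : Prop :=
  ∃ S : ∀ m : ℕ, Set (F _⦋m + 1⦌),
    (∀ m, ∀ b ∈ S m, ∀ i : Fin (m + 1), F.d i.castSucc b = 0) ∧
    ∀ n, Function.Bijective (F.freeMap S n)

/-- `E` is `n`-skeletal: morphisms from `E` to any simplicial algebra are the same as morphisms of
the `n`-truncations, i.e. `E` is the value at its own `n`-truncation of the left adjoint of the
truncation functor. -/
def IsSkeletal (n : ℕ) (E : SimpAlg.{u, v} k) : Prop :=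
  ∀ Y : SimpAlg.{u, v} k, Function.Bijective
    (fun g : E ⟶ Y => (SimplicialObject.truncation n).map g)

/-- `ι : E → F` exhibits `E` as the `n`-skeleton of `F`: `E` is `n`-skeletal and `ι` is an
isomorphism on `n`-truncations. -/
structure IsSkeleton (n : ℕ) {E F : SimpAlg.{u, v} k} (ι : E ⟶ F) : Prop where
  isIso_truncation : IsIso ((SimplicialObject.truncation n).map ι)
  skeletal : E.IsSkeletal n

/-! #### The Moore complex and its crossed square -/

/-- The Moore complex `NE_n = ⋂_{i < n} Ker d_i`, as an ideal of `E_n`. -/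
def moore (E : SimpAlg.{u, v} k) (n : ℕ) : Ideal (E _⦋n⦌) :=
  match n with
  | 0 => ⊤
  | n + 1 => ⨅ i : Fin (n + 1), RingHom.ker (E.d i.castSucc)

/-- The boundaries `∂_{n+1} (NE_{n+1}) = d_{n+1} (NE_{n+1})`, which form a sub-`E_n`-module
(that is, an ideal) of `NE_n`. -/
def boundaries (E : SimpAlg.{u, v} k) (n : ℕ) : Submodule (E _⦋n⦌) (E.moore n) where
  carrier := {z | ∃ w ∈ E.moore (n + 1), E.d (Fin.last (n + 1)) w = z}
  zero_mem' := ⟨0, zero_mem _, map_zero _⟩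
  add_mem' := by
    rintro a b ⟨w, hw, hwa⟩ ⟨w', hw', hwb⟩
    exact ⟨w + w', add_mem hw hw', by rw [map_add, hwa, hwb]; rfl⟩
  smul_mem' := by
    rintro e a ⟨w, hw, hwa⟩
    refine ⟨E.s (Fin.last n) e * w, Ideal.mul_mem_left _ _ hw, ?_⟩
    have h : E.d (Fin.last (n + 1)) (E.s (Fin.last n) e) = e := by
      have := E.δ_comp_σ_succ (i := Fin.last n)
      exact congrArg (fun f => f.hom e) this
    rw [map_mul, h, hwa]
    rfl

/-- The top corner `NE_2 / ∂_3 (NE_3)` of the crossed square of `E`. -/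
def TopCorner (E : SimpAlg.{u, v} k) : Type v := E.moore 2 ⧸ E.boundaries 2

namespace TopCorner

variable (E : SimpAlg.{u, v} k)

instance : AddCommGroup E.TopCorner := inferInstanceAs (AddCommGroup (E.moore 2 ⧸ E.boundaries 2))

/-- The class in `NE_2 / ∂_3 (NE_3)` of an element of `NE_2`. -/
def mk : E.moore 2 →+ E.TopCorner := (E.boundaries 2).mkQ.toAddMonoidHom

variable {E}

theorem mk_surjective : Function.Surjective (mk E) := Submodule.Quotient.mk_surjective _

theorem mk_eq_zero {z : E.moore 2} : mk E z = 0 ↔ z ∈ E.boundaries 2 :=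
  Submodule.Quotient.mk_eq_zero _

theorem mk_eq {z z' : E.moore 2} : mk E z = mk E z' ↔ z - z' ∈ E.boundaries 2 :=
  Submodule.Quotient.eq _

/-- The multiplication of `NE_2 / ∂_3 (NE_3)` is induced by that of `NE_2`. -/
instance : Mul E.TopCorner where
  mul a b := Quotient.liftOn₂' a b (fun z w => mk E (z * w)) (by
    intro z w z' w' hz hw
    have hz' : z - z' ∈ E.boundaries 2 := (Submodule.quotientRel_def _).1 hz
    have hw' : w - w' ∈ E.boundaries 2 := (Submodule.quotientRel_def _).1 hw
    rw [mk_eq]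
    have h : z * w - z' * w' = (w : E _⦋2⦌) • (z - z') + (z' : E _⦋2⦌) • (w - w') := by
      ext
      simp only [Submodule.coe_sub, Submodule.coe_add, Submodule.coe_smul, smul_eq_mul,
        MulMemClass.coe_mul]
      ring
    rw [h]
    exact add_mem (Submodule.smul_mem _ _ hz') (Submodule.smul_mem _ _ hw'))

theorem mk_mul (z w : E.moore 2) : mk E (z * w) = mk E z * mk E w := rfl

instance : NonUnitalCommRing E.TopCorner where
  left_distrib a b c := by
    obtain ⟨a, rfl⟩ := mk_surjective a
    obtain ⟨b, rfl⟩ := mk_surjective b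
    obtain ⟨c, rfl⟩ := mk_surjective c
    simp only [← mk_mul, ← map_add, mul_add]
  right_distrib a b c := by
    obtain ⟨a, rfl⟩ := mk_surjective a
    obtain ⟨b, rfl⟩ := mk_surjective b
    obtain ⟨c, rfl⟩ := mk_surjective c
    simp only [← mk_mul, ← map_add, add_mul]
  zero_mul a := by
    obtain ⟨a, rfl⟩ := mk_surjective a
    rw [← map_zero (mk E), ← mk_mul, zero_mul]
  mul_zero a := by
    obtain ⟨a, rfl⟩ := mk_surjective a
    rw [← map_zero (mk E), ← mk_mul, mul_zero]
  mul_assoc a b c := by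
    obtain ⟨a, rfl⟩ := mk_surjective a
    obtain ⟨b, rfl⟩ := mk_surjective b
    obtain ⟨c, rfl⟩ := mk_surjective c
    simp only [← mk_mul, mul_assoc]
  mul_comm a b := by
    obtain ⟨a, rfl⟩ := mk_surjective a
    obtain ⟨b, rfl⟩ := mk_surjective b
    rw [← mk_mul, ← mk_mul, mul_comm]

/-- The action of `E_1` on `NE_2 / ∂_3 (NE_3)`: an element `e` acts as multiplication by `s_1 e`. -/
instance : Module (E _⦋1⦌) E.TopCorner :=
  letI : Module (E _⦋2⦌) E.TopCorner :=
    inferInstanceAs (Module (E _⦋2⦌) (E.moore 2 ⧸ E.boundaries 2))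
  Module.compHom E.TopCorner (E.s (1 : Fin 2) : E _⦋1⦌ →+* E _⦋2⦌)

theorem smul_mk (e : E _⦋1⦌) (z : E.moore 2) :
    e • mk E z = mk E ((E.s (1 : Fin 2) e : E _⦋2⦌) • z) := rfl

end TopCorner

variable (E : SimpAlg.{u, v} k)

/-- The ideal `Ker (d_i : E_1 → E_0)` of `E_1`. -/
abbrev kerD (i : Fin 2) : Ideal (E _⦋1⦌) := RingHom.ker (E.d i)

/-- The crossed module given by the inclusion of `Ker (d_i : E_1 → E_0)` in `E_1`. -/
def kerCM (i : Fin 2) : CrossedModule (E _⦋1⦌) (E.kerD i) := CrossedModule.ofIdeal _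

variable {E}

theorem d_d {n : ℕ} {i j : Fin (n + 2)} (h : i ≤ j) (x : E _⦋n + 2⦌) :
    E.d i (E.d j.succ x) = E.d j (E.d i.castSucc x) :=
  congrArg (fun f => f.hom x) (E.δ_comp_δ h)

theorem mem_moore_two {z : E _⦋2⦌} :
    z ∈ E.moore 2 ↔ E.d (0 : Fin 3) z = 0 ∧ E.d (1 : Fin 3) z = 0 := by
  change z ∈ (⨅ i : Fin 2, RingHom.ker (E.d i.castSucc) : Ideal (E _⦋2⦌)) ↔ _
  simp only [Ideal.mem_iInf, Fin.forall_fin_two, RingHom.mem_ker]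
  rfl

theorem mem_moore_three {w : E _⦋3⦌} (hw : w ∈ E.moore 3) (i : Fin 3) :
    E.d i.castSucc w = 0 := by
  change w ∈ (⨅ i : Fin 3, RingHom.ker (E.d i.castSucc) : Ideal (E _⦋3⦌)) at hw
  exact (Ideal.mem_iInf.1 hw) i

theorem d_two_mem {z : E _⦋2⦌} (hz : z ∈ E.moore 2) (i : Fin 2) : E.d (2 : Fin 3) z ∈ E.kerD i := by
  rw [mem_moore_two] at hz
  rw [RingHom.mem_ker]
  have h := d_d (E := E) (i := i) (j := 1) (Fin.le_last i) z
  change E.d i (E.d (2 : Fin 3) z) = _ at h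
  rw [h]
  have hi : E.d i.castSucc z = 0 := by
    fin_cases i
    · exact hz.1
    · exact hz.2
  rw [hi, map_zero]

variable (E)

/-- The morphisms `NE_2 / ∂_3 (NE_3) → Ker d_i` (for `i = 0, 1`) of the crossed square of `E`; both
are induced by `d_2`. -/
def topBd (i : Fin 2) : E.TopCorner →+ E.kerD i :=
  QuotientAddGroup.lift (E.boundaries 2).toAddSubgroup
    { toFun := fun z => ⟨E.d (2 : Fin 3) z.1, d_two_mem z.2 i⟩
      map_zero' := Subtype.ext (map_zero _)
      map_add' := fun z z' => Subtype.ext (map_add _ _ _) }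
    (by
      rintro z ⟨w, hw, hwz⟩
      refine Subtype.ext ?_
      change E.d (2 : Fin 3) z.1 = 0
      rw [← hwz]
      change E.d (2 : Fin 3) (E.d (2 : Fin 3).succ w) = 0
      rw [d_d le_rfl, mem_moore_three hw 2, map_zero])

theorem topBd_mk (i : Fin 2) (z : E.moore 2) :
    (E.topBd i (TopCorner.mk E z) : E _⦋1⦌) = E.d (2 : Fin 3) z.1 := rfl

/-- The natural bijection `y ↦ ȳ = y - s_0 d_1 y` from `Ker d_0` to `Ker d_1`. -/
def bar (y : E.kerD 0) : E.kerD 1 :=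
  ⟨y - E.s (0 : Fin 1) (E.d (1 : Fin 2) y), by
    have h : E.d (1 : Fin 2) (E.s (0 : Fin 1) (E.d (1 : Fin 2) (y : E _⦋1⦌)))
        = E.d (1 : Fin 2) (y : E _⦋1⦌) :=
      congrArg (fun f => f.hom (E.d (1 : Fin 2) (y : E _⦋1⦌))) (E.δ_comp_σ_succ (i := (0 : Fin 1)))
    rw [RingHom.mem_ker, map_sub, h, sub_self]⟩

/-- `y ↦ ȳ` is a bijection; its inverse is `z ↦ z - s_0 d_0 z`. -/
theorem bar_bijective : Function.Bijective E.bar := by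
  have h0 : ∀ r : E _⦋0⦌, E.d (0 : Fin 2) (E.s (0 : Fin 1) r) = r := fun r =>
    congrArg (fun f => f.hom r) (E.δ_comp_σ_self (i := (0 : Fin 1)))
  have h1 : ∀ r : E _⦋0⦌, E.d (1 : Fin 2) (E.s (0 : Fin 1) r) = r := fun r =>
    congrArg (fun f => f.hom r) (E.δ_comp_σ_succ (i := (0 : Fin 1)))
  refine Function.bijective_iff_has_inverse.2
    ⟨fun z => ⟨z - E.s (0 : Fin 1) (E.d (0 : Fin 2) z), ?_⟩, fun y => ?_, fun z => ?_⟩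
  · rw [RingHom.mem_ker, map_sub, h0, sub_self]
  · have hy : E.d (0 : Fin 2) (y : E _⦋1⦌) = 0 := y.2
    refine Subtype.ext ?_
    simp only [bar, map_sub, h0, hy]
    simp
  · have hz : E.d (1 : Fin 2) (z : E _⦋1⦌) = 0 := z.2
    refine Subtype.ext ?_
    simp only [bar, map_sub, h1, hz]
    simp

/-- The element `s_1 x (s_1 y - s_0 y)` of `NE_2`, for `x, y` in `Ker d_0`. -/
def hElt (x y : E.kerD 0) : E.moore 2 :=
  ⟨E.s (1 : Fin 2) x * (E.s (1 : Fin 2) y - E.s (0 : Fin 2) y), by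
    have hx : E.d (0 : Fin 2) (x : E _⦋1⦌) = 0 := x.2
    have h0 : E.d (0 : Fin 3) (E.s (1 : Fin 2) (x : E _⦋1⦌))
        = E.s (0 : Fin 1) (E.d (0 : Fin 2) (x : E _⦋1⦌)) :=
      congrArg (fun f => f.hom (x : E _⦋1⦌))
        (E.δ_comp_σ_of_le (i := (0 : Fin 2)) (j := (0 : Fin 1)) (by simp))
    have h1 : E.d (1 : Fin 3) (E.s (1 : Fin 2) (y : E _⦋1⦌)) = y :=
      congrArg (fun f => f.hom (y : E _⦋1⦌)) (E.δ_comp_σ_self (i := (1 : Fin 2)))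
    have h2 : E.d (1 : Fin 3) (E.s (0 : Fin 2) (y : E _⦋1⦌)) = y :=
      congrArg (fun f => f.hom (y : E _⦋1⦌)) (E.δ_comp_σ_succ (i := (0 : Fin 2)))
    rw [mem_moore_two]
    refine ⟨?_, ?_⟩
    · rw [map_mul, h0, hx, map_zero, zero_mul]
    · rw [map_mul, map_sub, h1, h2, sub_self, mul_zero]⟩

end SimpAlg

end

/-!
Mapping `E` into the simplicial algebras coinduced from an arbitrary algebra at `⦋n + 1⦌` turns
`1`-skeletality into a universal property of `E_{n+1}`: it is the pushout of `E_n` and `E_1` over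
`E_0`. Hence `E_n` is the `n`-fold tensor power of `E_1` over `E_0`.

The symbol `z ⊗ x` is sent to the class of `s_1 x (s_1 z - s_0 z)`. This respects the action of
`E_1` because `Ker d_2 · NE_2 ⊆ ∂_3 NE_3`. In the other direction, with `E_2 = E_1 ⊗ E_1`, the
additive map `a ⊗ b ↦ -(b - s_0 d_1 b) ⊗ (a - s_0 d_0 a)` is a cocycle on the tensor powers, so it
vanishes on `∂_3 NE_3`. It is inverse to the first map because, up to sign, projecting `a ⊗ b` to
`NE_2` gives the element attached to `(b - s_0 d_1 b) ⊗ (a - s_0 d_0 a)`.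
-/

namespace SimpAlg

open Opposite SimplexCategory

variable {k : Type u} [CommRing k]

section Coinduced

variable {E : SimpAlg.{u, v} k} {n : ℕ} {c : SimplexCategory} {A : CommAlgCat.{v} k}

/-- The simplicial algebra `X ↦ A ^ Hom(c, X)` coinduced from `A` at `c`, that is, the value at `A`
of the right adjoint of evaluation at `c`. -/
def coinduced (c : SimplexCategory) (A : CommAlgCat.{v} k) : SimpAlg.{u, v} k where
  obj X := .of k ((c ⟶ X.unop) → A)
  map f := CommAlgCat.ofHom (AlgHom.pi fun a => Pi.evalAlgHom k _ (a ≫ f.unop))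

/-- The morphism into a coinduced simplicial algebra that corresponds to `f` under the
adjunction. -/
def toCoinduced (f : E.obj (op c) ⟶ A) : E ⟶ coinduced c A where
  app X := CommAlgCat.ofHom (AlgHom.pi fun a => (E.map a.op ≫ f).hom)
  naturality X Y g := by
    ext e
    funext a
    exact congrArg (fun φ => φ.hom e)
      (show E.map g ≫ E.map a.op ≫ f = E.map (a ≫ g.unop).op ≫ f by simp)

theorem toCoinduced_injective :
    Function.Injective (toCoinduced : (E.obj (op c) ⟶ A) → (E ⟶ coinduced c A)) := by
  intro f g h
  ext e
  have h_id : (E.map (𝟙 c).op ≫ f).hom e = (E.map (𝟙 c).op ≫ g).hom e :=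
    congrArg (fun φ : E ⟶ coinduced c A => (φ.app (op c)).hom e (𝟙 c)) h
  simpa only [op_id, E.map_id, Category.id_comp] using h_id

theorem IsSkeletal.hom_ext (hE : E.IsSkeletal n) {f g : E.obj (op c) ⟶ A}
    (h : ∀ ⦃X : SimplexCategory⦄, X.len ≤ n → ∀ a : c ⟶ X, E.map a.op ≫ f = E.map a.op ≫ g) :
    f = g := by
  refine toCoinduced_injective ((hE _).1 ?_)
  ext X e
  funext a
  exact congrArg (fun φ => φ.hom e) (h X.unop.property a)

theorem IsSkeletal.exists_desc (hE : E.IsSkeletal n)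
    (φ : ∀ X : SimplexCategory, (c ⟶ X) → (E.obj (op X) ⟶ A))
    (hφ : ∀ ⦃X Y : SimplexCategory⦄, X.len ≤ n → ∀ (a : c ⟶ X) (f : X ⟶ Y),
      E.map f.op ≫ φ X a = φ Y (a ≫ f)) :
    ∃ h : E.obj (op c) ⟶ A, ∀ ⦃X : SimplexCategory⦄, X.len ≤ n → ∀ a : c ⟶ X,
      E.map a.op ≫ h = φ X a := by
  let τ : (SimplicialObject.truncation n).obj E ⟶
      (SimplicialObject.truncation n).obj (coinduced c A) :=
    { app X := CommAlgCat.ofHom (AlgHom.pi fun a => (φ X.unop.obj a).hom)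
      naturality X Y g := by
        ext e
        funext a
        exact congrArg (fun φ => φ.hom e) (hφ Y.unop.property a g.unop.hom) }
  obtain ⟨g, hg⟩ := (hE (coinduced c A)).2 τ
  refine ⟨g.app (op c) ≫ CommAlgCat.ofHom (Pi.evalAlgHom k _ (𝟙 c)), fun X hX a => ?_⟩
  ext e
  have hga : (g.app (op X)).hom e = fun b => (φ X b).hom e :=
    congrArg (fun ψ : (SimplicialObject.truncation n).obj E ⟶ _ => (ψ.app (op ⟨X, hX⟩)).hom e) hg
  have hnat : (g.app (op c)).hom ((E.map a.op).hom e) =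
      ((coinduced c A).map a.op).hom ((g.app (op X)).hom e) :=
    congrArg (fun ψ => ψ.hom e) (g.naturality a.op)
  calc (g.app (op c)).hom ((E.map a.op).hom e) (𝟙 c)
      = (g.app (op X)).hom e (𝟙 c ≫ a) := congrFun hnat _
    _ = (φ X a).hom e := by rw [Category.id_comp, hga]

end Coinduced

/-- The map `⦋n + 1⦌ ⟶ ⦋1⦌` that separates the last vertex from the others. -/
abbrev lastCut (n : ℕ) : ⦋n + 1⦌ ⟶ ⦋1⦌ := toMk₁ (Fin.last (n + 1)).castSucc

theorem lastCut_apply_last (n : ℕ) : (lastCut n).toOrderHom (Fin.last (n + 1)) = 1 :=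
  toMk₁_of_le_castSucc _ _ le_rfl

theorem lastCut_apply_castSucc {n : ℕ} (i : Fin (n + 1)) :
    (lastCut n).toOrderHom i.castSucc = 0 :=
  toMk₁_of_castSucc_lt _ _ (Fin.castSucc_lt_castSucc_iff.2 i.castSucc_lt_last)

theorem mkOfSucc_last_comp_lastCut (n : ℕ) : mkOfSucc (Fin.last n) ≫ lastCut n = 𝟙 ⦋1⦌ :=
  Hom.ext_one_left _ _ (lastCut_apply_castSucc _) (lastCut_apply_last n)

theorem δ_last_comp_lastCut (n : ℕ) :
    δ (Fin.last (n + 1)) ≫ lastCut n = const ⦋n⦌ ⦋0⦌ 0 ≫ δ 1 := by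
  ext i : 3
  change (lastCut n).toOrderHom ((Fin.last (n + 1)).succAbove i) = 0
  rw [Fin.succAbove_last, lastCut_apply_castSucc]

theorem exists_eq_σ_last_comp_or_exists_eq_lastCut_comp {n : ℕ} {X : SimplexCategory}
    (hX : X.len ≤ 1) (a : ⦋n + 1⦌ ⟶ X) :
    (∃ b : ⦋n⦌ ⟶ X, a = σ (Fin.last n) ≫ b) ∨ ∃ c : ⦋1⦌ ⟶ X, a = lastCut n ≫ c := by
  by_cases h : a.toOrderHom (Fin.last n).castSucc = a.toOrderHom (Fin.last n).succ
  · exact .inl (eq_σ_comp_of_not_injective' a _ h)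
  refine .inr ⟨mkOfSucc (Fin.last n) ≫ a, ?_⟩
  have hlt : a.toOrderHom (Fin.last n).castSucc < a.toOrderHom (Fin.last n).succ :=
    lt_of_le_of_ne (a.toOrderHom.monotone (Fin.castSucc_le_succ _)) h
  ext i : 3
  simp only [comp_toOrderHom, OrderHom.comp_coe, Function.comp_apply]
  cases i using Fin.lastCases with
  | last => rw [lastCut_apply_last]; rfl
  | cast i =>
    have hle : a.toOrderHom i.castSucc ≤ a.toOrderHom (Fin.last n).castSucc :=
      a.toOrderHom.monotone (Fin.castSucc_le_castSucc_iff.2 (Fin.le_last i))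
    rw [lastCut_apply_castSucc, mkOfSucc_homToOrderHom_zero]
    omega

theorem exists_eq_const_comp {n : ℕ} {X : SimplexCategory} {b : ⦋n⦌ ⟶ X} {c : ⦋1⦌ ⟶ X}
    (h : σ (Fin.last n) ≫ b = lastCut n ≫ c) :
    ∃ p : ⦋0⦌ ⟶ X, b = const _ _ 0 ≫ p ∧ c = const _ _ 0 ≫ p := by
  have hb : b = const _ ⦋0⦌ 0 ≫ δ 1 ≫ c :=
    calc b = δ (Fin.last n).succ ≫ σ (Fin.last n) ≫ b := by rw [δ_comp_σ_succ_assoc]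
      _ = δ (Fin.last (n + 1)) ≫ lastCut n ≫ c := by rw [h, Fin.succ_last]
      _ = const _ ⦋0⦌ 0 ≫ δ 1 ≫ c := by
        rw [← Category.assoc, δ_last_comp_lastCut, Category.assoc]
  refine ⟨δ 1 ≫ c, hb, ?_⟩
  calc c = mkOfSucc (Fin.last n) ≫ lastCut n ≫ c := by
        rw [← Category.assoc, mkOfSucc_last_comp_lastCut, Category.id_comp]
    _ = mkOfSucc (Fin.last n) ≫ σ (Fin.last n) ≫ const ⦋n⦌ ⦋0⦌ 0 ≫ δ 1 ≫ c := by rw [← h, ← hb]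
    _ = const ⦋1⦌ ⦋0⦌ 0 ≫ δ 1 ≫ c := rfl

section LastVertex

variable {E : SimpAlg.{u, v} k} {A : CommAlgCat.{v} k} {n : ℕ}

theorem IsSkeletal.exists_desc_last (hE : E.IsSkeletal 1) {f : E _⦋n⦌ ⟶ A} {g : E _⦋1⦌ ⟶ A}
    (hfg : E.map (const ⦋n⦌ ⦋0⦌ 0).op ≫ f = E.map (const ⦋1⦌ ⦋0⦌ 0).op ≫ g) :
    ∃ h : E _⦋n + 1⦌ ⟶ A, E.σ (Fin.last n) ≫ h = f ∧ E.map (lastCut n).op ≫ h = g := by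
  classical
  have h_overlap : ∀ {X : SimplexCategory} {b : ⦋n⦌ ⟶ X} {c : ⦋1⦌ ⟶ X},
      σ (Fin.last n) ≫ b = lastCut n ≫ c → E.map b.op ≫ f = E.map c.op ≫ g := by
    intro X b c hbc
    obtain ⟨p, rfl, rfl⟩ := exists_eq_const_comp hbc
    simp only [op_comp, E.map_comp, Category.assoc, hfg]
  let φ (X : SimplexCategory) (a : ⦋n + 1⦌ ⟶ X) : E.obj (op X) ⟶ A :=
    if a = σ (Fin.last n) ≫ δ (Fin.last (n + 1)) ≫ a
    then E.map (δ (Fin.last (n + 1)) ≫ a).op ≫ f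
    else E.map (mkOfSucc (Fin.last n) ≫ a).op ≫ g
  have hφσ : ∀ {X : SimplexCategory} (b : ⦋n⦌ ⟶ X),
      φ X (σ (Fin.last n) ≫ b) = E.map b.op ≫ f := by
    intro X b
    have hb : δ (Fin.last (n + 1)) ≫ σ (Fin.last n) ≫ b = b := by
      rw [← Fin.succ_last, δ_comp_σ_succ_assoc]
    simp only [φ, hb, if_true]
  have hφcut : ∀ {X : SimplexCategory} (c : ⦋1⦌ ⟶ X),
      φ X (lastCut n ≫ c) = E.map c.op ≫ g := by
    intro X c
    by_cases hc : lastCut n ≫ c = σ (Fin.last n) ≫ δ (Fin.last (n + 1)) ≫ lastCut n ≫ c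
    · rw [hc, hφσ, h_overlap hc.symm]
    · simp only [φ, if_neg hc]
      rw [← Category.assoc, mkOfSucc_last_comp_lastCut, Category.id_comp]
  obtain ⟨h, hh⟩ := hE.exists_desc φ fun X Y hX a e => by
    obtain ⟨b, rfl⟩ | ⟨c, rfl⟩ := exists_eq_σ_last_comp_or_exists_eq_lastCut_comp hX a
    · rw [Category.assoc, hφσ, hφσ, op_comp, E.map_comp, Category.assoc]
    · rw [Category.assoc, hφcut, hφcut, op_comp, E.map_comp, Category.assoc]
  refine ⟨h, hE.hom_ext fun X hX a => ?_, ?_⟩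
  · rw [← hφσ, ← hh hX, op_comp, E.map_comp, Category.assoc]
    rfl
  · have hcut := hh le_rfl (lastCut n ≫ 𝟙 ⦋1⦌)
    rwa [hφcut, op_id, E.map_id, Category.id_comp, Category.comp_id] at hcut

theorem IsSkeletal.hom_ext_last (hE : E.IsSkeletal 1) {f g : E _⦋n + 1⦌ ⟶ A}
    (hσ : E.σ (Fin.last n) ≫ f = E.σ (Fin.last n) ≫ g)
    (hcut : E.map (lastCut n).op ≫ f = E.map (lastCut n).op ≫ g) : f = g := by
  refine hE.hom_ext fun X hX a => ?_
  obtain ⟨b, rfl⟩ | ⟨c, rfl⟩ := exists_eq_σ_last_comp_or_exists_eq_lastCut_comp hX a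
  · rw [op_comp, E.map_comp, Category.assoc, Category.assoc]
    exact congrArg _ hσ
  · rw [op_comp, E.map_comp, Category.assoc, Category.assoc, hcut]

theorem IsSkeletal.isPushout (hE : E.IsSkeletal 1) (n : ℕ) :
    IsPushout (E.map (const ⦋n⦌ ⦋0⦌ 0).op) (E.map (const ⦋1⦌ ⦋0⦌ 0).op)
      (E.σ (Fin.last n)) (E.map (lastCut n).op) := by
  refine ⟨⟨?_⟩, ⟨Limits.PushoutCocone.IsColimit.mk _
    (fun t => (hE.exists_desc_last t.condition).choose)
    (fun t => (hE.exists_desc_last t.condition).choose_spec.1)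
    (fun t => (hE.exists_desc_last t.condition).choose_spec.2)
    fun t m hinl hinr => hE.hom_ext_last ?_ ?_⟩⟩
  · rw [SimplicialObject.σ, ← E.map_comp, ← E.map_comp]
    rfl
  · rw [hinl, (hE.exists_desc_last t.condition).choose_spec.1]
  · rw [hinr, (hE.exists_desc_last t.condition).choose_spec.2]

end LastVertex

section Pushout

variable {R A B C : CommAlgCat.{v} k} {f : R ⟶ A} {g : R ⟶ B} {i : A ⟶ C} {j : B ⟶ C}

theorem pushout_induction (h : IsPushout f g i j) {p : C → Prop}
    (mul : ∀ a b, p (i.hom a * j.hom b)) (add : ∀ c c', p c → p c' → p (c + c')) (c : C) :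
    p c := by
  let S := CommAlgCat.of k (Algebra.TensorProduct.productMap i.hom j.hom).range
  let ι : S ⟶ C := CommAlgCat.ofHom (Subalgebra.val _)
  let i' : A ⟶ S := CommAlgCat.ofHom (i.hom.codRestrict _ fun a => ⟨a ⊗ₜ 1, by simp⟩)
  let j' : B ⟶ S := CommAlgCat.ofHom (j.hom.codRestrict _ fun b => ⟨1 ⊗ₜ b, by simp⟩)
  have hw : f ≫ i' = g ≫ j' := by
    ext r
    exact congrArg (fun φ => φ.hom r) h.w
  have hι : h.desc i' j' hw ≫ ι = 𝟙 C := by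
    apply h.hom_ext
    · rw [h.inl_desc_assoc]; rfl
    · rw [h.inr_desc_assoc]; rfl
  obtain ⟨t, ht⟩ := ((h.desc i' j' hw).hom c).2
  obtain rfl : Algebra.TensorProduct.productMap i.hom j.hom t = c :=
    ht.trans (congrArg (fun φ => φ.hom c) hι)
  clear ht
  induction t with
  | zero => simpa using mul 0 0
  | tmul a b => simpa using mul a b
  | add t t' ht ht' => simpa using add _ _ ht ht'

theorem exists_addMonoidHom_of_isPushout (h : IsPushout f g i j) {M : Type*} [AddCommGroup M]
    (β : A →+ B →+ M) (hβ : ∀ r a b, β (f.hom r * a) b = β a (g.hom r * b)) :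
    ∃ ρ : C →+ M, ∀ a b, ρ (i.hom a * j.hom b) = β a b := by
  algebraize [f.hom.toRingHom, g.hom.toRingHom]
  have : IsScalarTower k R A := .of_algHom f.hom
  have : IsScalarTower k R B := .of_algHom g.hom
  let T := CommAlgCat.of k (A ⊗[R] B)
  let i' : A ⟶ T := CommAlgCat.ofHom Algebra.TensorProduct.includeLeft
  let j' : B ⟶ T := CommAlgCat.ofHom (Algebra.TensorProduct.includeRight.restrictScalars k)
  have hw : f ≫ i' = g ≫ j' := by
    ext r
    change algebraMap R A r ⊗ₜ[R] (1 : B) = 1 ⊗ₜ[R] algebraMap R B r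
    rw [Algebra.algebraMap_eq_smul_one, Algebra.algebraMap_eq_smul_one, TensorProduct.smul_tmul]
  have hdesc : ∀ a b, (h.desc i' j' hw).hom (i.hom a * j.hom b) = a ⊗ₜ[R] b := by
    intro a b
    have hi : (h.desc i' j' hw).hom (i.hom a) = a ⊗ₜ[R] 1 :=
      congrArg (fun φ => φ.hom a) (h.inl_desc i' j' hw)
    have hj : (h.desc i' j' hw).hom (j.hom b) = 1 ⊗ₜ[R] b :=
      congrArg (fun φ => φ.hom b) (h.inr_desc i' j' hw)
    rw [map_mul, hi, hj, Algebra.TensorProduct.tmul_mul_tmul, mul_one, one_mul]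
  refine ⟨(TensorProduct.liftAddHom β fun r a b => hβ r a b).comp
    (h.desc i' j' hw).hom.toRingHom.toAddMonoidHom, fun a b => ?_⟩
  exact congrArg (TensorProduct.liftAddHom β fun r a b => hβ r a b) (hdesc a b)

end Pushout

section Identities

variable {E : SimpAlg.{u, v} k} {n : ℕ}

theorem d_s_self (i : Fin (n + 1)) (x : E _⦋n⦌) : E.d i.castSucc (E.s i x) = x :=
  congrArg (fun f => f.hom x) E.δ_comp_σ_self

theorem d_s_succ (i : Fin (n + 1)) (x : E _⦋n⦌) : E.d i.succ (E.s i x) = x :=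
  congrArg (fun f => f.hom x) E.δ_comp_σ_succ

theorem d_s_of_le {i : Fin (n + 2)} {j : Fin (n + 1)} (h : i ≤ j.castSucc) (x : E _⦋n + 1⦌) :
    E.d i.castSucc (E.s j.succ x) = E.s j (E.d i x) :=
  congrArg (fun f => f.hom x) (E.δ_comp_σ_of_le h)

theorem d_s_of_gt {i : Fin (n + 2)} {j : Fin (n + 1)} (h : j.castSucc < i) (x : E _⦋n + 1⦌) :
    E.d i.succ (E.s j.castSucc x) = E.s j (E.d i x) :=
  congrArg (fun f => f.hom x) (E.δ_comp_σ_of_gt h)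

theorem s_s {i j : Fin (n + 1)} (h : i ≤ j) (x : E _⦋n⦌) :
    E.s i.castSucc (E.s j x) = E.s j.succ (E.s i x) :=
  congrArg (fun f => f.hom x) (E.σ_comp_σ h)

theorem mem_moore_succ {z : E _⦋n + 1⦌} :
    z ∈ E.moore (n + 1) ↔ ∀ i : Fin (n + 1), E.d i.castSucc z = 0 := by
  simp only [moore, Ideal.mem_iInf, RingHom.mem_ker]

theorem smul_mem_boundaries (u : E.moore (n + 1)) {t : E _⦋n + 1⦌}
    (ht : E.d (Fin.last (n + 1)) t = 0) : t • u ∈ E.boundaries (n + 1) := by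
  have hu := mem_moore_succ.1 u.2
  refine ⟨E.s (Fin.last (n + 1)) u * (E.s (Fin.last (n + 1)) t - E.s (Fin.last n).castSucc t),
    mem_moore_succ.2 fun i => ?_, ?_⟩
  · cases i using Fin.lastCases with
    | last =>
      have h : E.d (Fin.last (n + 1)).castSucc (E.s (Fin.last n).castSucc t) = t :=
        d_s_succ (Fin.last n).castSucc t
      rw [map_mul, map_sub, h, sub_eq_zero.2 (d_s_self _ t), mul_zero]
    | cast i =>
      have h : E.d i.castSucc.castSucc (E.s (Fin.last (n + 1)) u) = 0 := by
        rw [← Fin.succ_last n, d_s_of_le (Fin.castSucc_le_castSucc_iff.2 (Fin.le_last i)), hu,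
          map_zero]
      rw [map_mul, h, zero_mul]
  · have h : E.d (Fin.last (n + 2)) (E.s (Fin.last n).castSucc t) = 0 := by
      rw [← Fin.succ_last, d_s_of_gt (Fin.castSucc_lt_last _), ht, map_zero]
    have h' (e : E _⦋n + 1⦌) : E.d (Fin.last (n + 2)) (E.s (Fin.last (n + 1)) e) = e := by
      rw [← Fin.succ_last (n + 1), d_s_succ]
    rw [map_mul, map_sub, h', h', h, sub_zero, mul_comm]
    rfl

end Identities

section Spanning

variable {E : SimpAlg.{u, v} k}

theorem IsSkeletal.isPushout_two (hE : E.IsSkeletal 1) :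
    IsPushout (E.σ (0 : Fin 1)) (E.σ (0 : Fin 1)) (E.σ (1 : Fin 2)) (E.σ (0 : Fin 2)) := by
  have hcut : lastCut 1 = σ 0 := by decide
  have hconst : const ⦋1⦌ ⦋0⦌ 0 = σ 0 := by decide
  have h := hE.isPushout 1
  rwa [hcut, hconst] at h

theorem IsSkeletal.induction_two (hE : E.IsSkeletal 1) {p : E _⦋2⦌ → Prop}
    (mul : ∀ a b, p (E.s (1 : Fin 2) a * E.s (0 : Fin 2) b))
    (add : ∀ w w', p w → p w' → p (w + w')) (w : E _⦋2⦌) : p w :=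
  pushout_induction hE.isPushout_two mul add w

/-- The element of `E_3` that corresponds to `a ⊗ b ⊗ c` in the threefold tensor power of `E_1`
over `E_0`. -/
def tripleProduct (a b c : E _⦋1⦌) : E _⦋3⦌ :=
  E.s (2 : Fin 3) (E.s (1 : Fin 2) a * E.s (0 : Fin 2) b) * E.s (1 : Fin 3) (E.s (0 : Fin 2) c)

theorem IsSkeletal.induction_three (hE : E.IsSkeletal 1) {p : E _⦋3⦌ → Prop}
    (mul : ∀ a b c, p (tripleProduct a b c))
    (add : ∀ w w', p w → p w' → p (w + w')) (w : E _⦋3⦌) : p w := by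
  have hcut : lastCut 2 = σ 1 ≫ σ 0 := by decide
  have hcut' (c : E _⦋1⦌) : (E.map (lastCut 2).op).hom c = E.s (1 : Fin 3) (E.s (0 : Fin 2) c) := by
    rw [hcut, op_comp, E.map_comp]
    rfl
  refine pushout_induction (hE.isPushout 2) (fun v c => ?_) add w
  rw [hcut']
  induction v using hE.induction_two with
  | mul a b => exact mul a b c
  | add v v' hv hv' => rw [map_add, add_mul]; exact add _ _ hv hv'

end Spanning

section LowIdentities

variable {E : SimpAlg.{u, v} k}

theorem d_zero_s_zero (a : E _⦋1⦌) : E.d (0 : Fin 3) (E.s (0 : Fin 2) a) = a :=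
  d_s_self (0 : Fin 2) a

theorem d_one_s_zero (a : E _⦋1⦌) : E.d (1 : Fin 3) (E.s (0 : Fin 2) a) = a :=
  d_s_succ (0 : Fin 2) a

theorem d_two_s_zero (a : E _⦋1⦌) :
    E.d (2 : Fin 3) (E.s (0 : Fin 2) a) = E.s (0 : Fin 1) (E.d (1 : Fin 2) a) :=
  d_s_of_gt (i := 1) (j := (0 : Fin 1)) Fin.zero_lt_one a

theorem d_zero_s_one (a : E _⦋1⦌) :
    E.d (0 : Fin 3) (E.s (1 : Fin 2) a) = E.s (0 : Fin 1) (E.d (0 : Fin 2) a) :=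
  d_s_of_le (i := 0) (j := (0 : Fin 1)) le_rfl a

theorem d_one_s_one (a : E _⦋1⦌) : E.d (1 : Fin 3) (E.s (1 : Fin 2) a) = a :=
  d_s_self (1 : Fin 2) a

theorem d_two_s_one (a : E _⦋1⦌) : E.d (2 : Fin 3) (E.s (1 : Fin 2) a) = a :=
  d_s_succ (1 : Fin 2) a

theorem s_one_s_zero (r : E _⦋0⦌) :
    E.s (1 : Fin 2) (E.s (0 : Fin 1) r) = E.s (0 : Fin 2) (E.s (0 : Fin 1) r) :=
  (s_s (le_refl (0 : Fin 1)) r).symm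

end LowIdentities

section Pairing

variable {E : SimpAlg.{u, v} k}

/-- The element `s_1 x (s_1 e - s_0 e)` of `NE_2`, for `x` in `Ker d_0` and `e` in `E_1`. -/
def pairing (x : E.kerD 0) (e : E _⦋1⦌) : E.moore 2 :=
  ⟨E.s (1 : Fin 2) x * (E.s (1 : Fin 2) e - E.s (0 : Fin 2) e), by
    have hx : E.d (0 : Fin 2) (x : E _⦋1⦌) = 0 := x.2
    simp [mem_moore_two, d_zero_s_one, d_one_s_one, d_one_s_zero, hx]⟩

theorem coe_pairing (x : E.kerD 0) (e : E _⦋1⦌) :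
    (pairing x e : E _⦋2⦌) = E.s (1 : Fin 2) x * (E.s (1 : Fin 2) e - E.s (0 : Fin 2) e) :=
  rfl

theorem d_two_pairing (x : E.kerD 0) (e : E _⦋1⦌) :
    E.d (2 : Fin 3) (pairing x e : E _⦋2⦌) = x * (e - E.s (0 : Fin 1) (E.d (1 : Fin 2) e)) := by
  rw [coe_pairing, map_mul, map_sub, d_two_s_one, d_two_s_one, d_two_s_zero]

theorem pairing_bar (x y : E.kerD 0) : pairing x (E.bar y : E _⦋1⦌) = E.hElt x y := by
  apply Subtype.ext
  simp only [coe_pairing, bar, hElt, map_sub, s_one_s_zero]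
  ring

theorem pairing_add_left (x x' : E.kerD 0) (e : E _⦋1⦌) :
    pairing (x + x') e = pairing x e + pairing x' e := by
  apply Subtype.ext
  simp only [coe_pairing, Submodule.coe_add, map_add]
  ring

theorem pairing_add_right (x : E.kerD 0) (e e' : E _⦋1⦌) :
    pairing x (e + e') = pairing x e + pairing x e' := by
  apply Subtype.ext
  simp only [coe_pairing, Submodule.coe_add, map_add]
  ring

theorem pairing_smul_left (r : E _⦋1⦌) (x : E.kerD 0) (e : E _⦋1⦌) :
    pairing (r • x) e = E.s (1 : Fin 2) r • pairing x e := by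
  apply Subtype.ext
  simp only [coe_pairing, Submodule.coe_smul, smul_eq_mul, map_mul]
  ring

theorem pairing_mul_right (x : E.kerD 0) (r e : E _⦋1⦌) :
    pairing x (r * e) =
      E.s (1 : Fin 2) r • pairing x e + E.s (0 : Fin 2) e • pairing x r := by
  apply Subtype.ext
  simp only [coe_pairing, Submodule.coe_add, Submodule.coe_smul, smul_eq_mul, map_mul]
  ring

theorem pairing_mul_pairing (x x' : E.kerD 0) (e e' : E _⦋1⦌) :
    pairing x e * pairing x' e' = pairing (x * x') (e * e') -
      E.s (0 : Fin 2) e • E.s (1 : Fin 2) x • pairing x' e' -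
      E.s (0 : Fin 2) e' • E.s (1 : Fin 2) x' • pairing x e := by
  apply Subtype.ext
  simp only [coe_pairing, Submodule.coe_sub, Submodule.coe_smul, smul_eq_mul, map_mul,
    MulMemClass.coe_mul]
  ring

theorem TopCorner.mk_s_zero_smul {z : E _⦋1⦌} (hz : E.d (1 : Fin 2) z = 0) (u : E.moore 2) :
    TopCorner.mk E (E.s (0 : Fin 2) z • u) = 0 :=
  mk_eq_zero.2 (smul_mem_boundaries u (by
    change E.d (2 : Fin 3) _ = 0
    rw [d_two_s_zero, hz, map_zero]))

instance : IsScalarTower (E _⦋1⦌) E.TopCorner E.TopCorner where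
  smul_assoc r a b := by
    obtain ⟨a, rfl⟩ := TopCorner.mk_surjective a
    obtain ⟨b, rfl⟩ := TopCorner.mk_surjective b
    rw [smul_eq_mul, smul_eq_mul, TopCorner.smul_mk, ← TopCorner.mk_mul, ← TopCorner.mk_mul,
      TopCorner.smul_mk, smul_mul_assoc]

instance : SMulCommClass (E _⦋1⦌) E.TopCorner E.TopCorner where
  smul_comm r a b := by
    rw [smul_eq_mul, smul_eq_mul, mul_comm, mul_comm a, smul_mul_assoc]

variable (E) in
theorem exists_comparison :
    ∃ φ : (E.kerCM 1).Tensor (E.kerCM 0) →ₙₐ[E _⦋1⦌] E.TopCorner,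
      ∀ (z : E.kerD 1) (x : E.kerD 0), φ (z ⊗ₜ[E _⦋1⦌] x) = TopCorner.mk E (pairing x z) := by
  refine ((E.kerCM 1).tensor_presentation (E.kerCM 0)
    (fun z x => TopCorner.mk E (pairing x (z : E _⦋1⦌))) ?_ ?_ ?_ ?_ ?_).exists
  · intro r z x
    simp only [Submodule.coe_smul, smul_eq_mul, pairing_mul_right, map_add,
      TopCorner.mk_s_zero_smul z.2, add_zero, TopCorner.smul_mk]
  · intro r z x
    rw [pairing_smul_left, TopCorner.smul_mk]
  · intro z z' x
    rw [Submodule.coe_add, pairing_add_right, map_add]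
  · intro z x x'
    rw [pairing_add_left, map_add]
  · intro z z' x x'
    simp only [← TopCorner.mk_mul, pairing_mul_pairing, MulMemClass.coe_mul, map_sub,
      TopCorner.mk_s_zero_smul z.2, TopCorner.mk_s_zero_smul z'.2, sub_zero]

variable (E) in
/-- The comparison morphism `Ker d_1 ⊗ Ker d_0 → NE_2 / ∂_3 NE_3` of the crossed square of `E`. -/
noncomputable def comparison : (E.kerCM 1).Tensor (E.kerCM 0) →ₙₐ[E _⦋1⦌] E.TopCorner :=
  E.exists_comparison.choose

theorem comparison_tmul (z : E.kerD 1) (x : E.kerD 0) :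
    E.comparison (z ⊗ₜ x) = TopCorner.mk E (pairing x z) :=
  E.exists_comparison.choose_spec z x

theorem comparison_bar_tmul (x y : E.kerD 0) :
    E.comparison (E.bar y ⊗ₜ x) = TopCorner.mk E (E.hElt x y) := by
  rw [comparison_tmul, pairing_bar]

theorem coe_topBd_comparison_tmul (i : Fin 2) (z : E.kerD 1) (x : E.kerD 0) :
    (E.topBd i (E.comparison (z ⊗ₜ x)) : E _⦋1⦌) = x * z := by
  have hz : E.d (1 : Fin 2) (z : E _⦋1⦌) = 0 := z.2
  rw [comparison_tmul, topBd_mk, d_two_pairing, hz, map_zero, sub_zero]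

theorem topBd_one_comparison (t : (E.kerCM 1).Tensor (E.kerCM 0)) :
    E.topBd 1 (E.comparison t) = (E.kerCM 1).tensorFst (E.kerCM 0) t := by
  induction t using TensorProduct.induction_on with
  | zero => simp only [map_zero]
  | add t t' ht ht' => simp only [map_add, ht, ht']
  | tmul z x => exact Subtype.ext (coe_topBd_comparison_tmul 1 z x)

theorem topBd_zero_comparison (t : (E.kerCM 1).Tensor (E.kerCM 0)) :
    E.topBd 0 (E.comparison t) = (E.kerCM 1).tensorSnd (E.kerCM 0) t := by
  induction t using TensorProduct.induction_on with
  | zero => simp only [map_zero]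
  | add t t' ht ht' => simp only [map_add, ht, ht']
  | tmul z x => exact Subtype.ext ((coe_topBd_comparison_tmul 0 z x).trans (mul_comm _ _))

end Pairing

section Projection

variable {E : SimpAlg.{u, v} k}

theorem d_s_zero (i : Fin 2) (r : E _⦋0⦌) : E.d i (E.s (0 : Fin 1) r) = r := by
  fin_cases i
  exacts [d_s_self 0 r, d_s_succ 0 r]

/-- The projection `a ↦ a - s_0 d_i a` of `E_1` onto `Ker d_i`. -/
def kerProj (i : Fin 2) : E _⦋1⦌ →+ E.kerD i :=
  .mk' (fun a => ⟨a - E.s (0 : Fin 1) (E.d i a), by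
      rw [RingHom.mem_ker, map_sub, d_s_zero, sub_self]⟩)
    fun a b => Subtype.ext (by
      simp only [map_add, Submodule.coe_add]
      ring)

theorem coe_kerProj (i : Fin 2) (a : E _⦋1⦌) :
    (kerProj i a : E _⦋1⦌) = a - E.s (0 : Fin 1) (E.d i a) :=
  rfl

theorem kerProj_coe {i : Fin 2} (x : E.kerD i) : kerProj i (x : E _⦋1⦌) = x := by
  have hx : E.d i (x : E _⦋1⦌) = 0 := x.2
  apply Subtype.ext
  rw [coe_kerProj, hx, map_zero, sub_zero]

theorem kerProj_one (i : Fin 2) : kerProj i (1 : E _⦋1⦌) = 0 := by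
  apply Subtype.ext
  rw [coe_kerProj, map_one, map_one, sub_self, Submodule.coe_zero]

theorem kerProj_mul (i : Fin 2) (a b : E _⦋1⦌) :
    kerProj i (a * b) = b • kerProj i a + E.s (0 : Fin 1) (E.d i a) • kerProj i b := by
  apply Subtype.ext
  simp only [coe_kerProj, Submodule.coe_add, Submodule.coe_smul, smul_eq_mul, map_mul]
  ring

theorem kerProj_s_mul (i : Fin 2) (r : E _⦋0⦌) (a : E _⦋1⦌) :
    kerProj i (E.s (0 : Fin 1) r * a) = E.s (0 : Fin 1) r • kerProj i a := by
  apply Subtype.ext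
  simp only [coe_kerProj, Submodule.coe_smul, smul_eq_mul, map_mul, d_s_zero]
  ring

/-- The projection `w ↦ w - s_0 d_0 w - s_1 d_1 w + s_1 d_0 w` of `E_2` onto `NE_2`. -/
def moorePart : E _⦋2⦌ →+ E.moore 2 :=
  .mk' (fun w => ⟨w - E.s (0 : Fin 2) (E.d (0 : Fin 3) w) - E.s (1 : Fin 2) (E.d (1 : Fin 3) w) +
      E.s (1 : Fin 2) (E.d (0 : Fin 3) w), by
      have hd : E.d (0 : Fin 2) (E.d (1 : Fin 3) w) = E.d (0 : Fin 2) (E.d (0 : Fin 3) w) :=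
        d_d (le_refl (0 : Fin 2)) w
      simp only [mem_moore_two, map_add, map_sub, d_zero_s_zero, d_zero_s_one, d_one_s_zero,
        d_one_s_one, hd]
      constructor <;> ring⟩)
    fun w w' => Subtype.ext (by
      simp only [map_add, Submodule.coe_add]
      ring)

theorem coe_moorePart (w : E _⦋2⦌) :
    (moorePart w : E _⦋2⦌) = w - E.s (0 : Fin 2) (E.d (0 : Fin 3) w) -
      E.s (1 : Fin 2) (E.d (1 : Fin 3) w) + E.s (1 : Fin 2) (E.d (0 : Fin 3) w) :=
  rfl

theorem moorePart_coe (u : E.moore 2) : moorePart (u : E _⦋2⦌) = u := by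
  obtain ⟨h₀, h₁⟩ := mem_moore_two.1 u.2
  apply Subtype.ext
  rw [coe_moorePart, h₀, h₁]
  simp only [map_zero, sub_zero, add_zero]

theorem moorePart_s_mul_s (a b : E _⦋1⦌) :
    moorePart (E.s (1 : Fin 2) a * E.s (0 : Fin 2) b) =
      -pairing (kerProj 0 a) (kerProj 1 b : E _⦋1⦌) := by
  apply Subtype.ext
  simp only [coe_moorePart, coe_pairing, coe_kerProj, Submodule.coe_neg, map_mul, map_sub,
    d_zero_s_zero, d_one_s_zero, d_zero_s_one, d_one_s_one, s_one_s_zero]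
  ring

end Projection

section Faces

variable {E : SimpAlg.{u, v} k}

theorem d_zero_tripleProduct (a b c : E _⦋1⦌) :
    E.d (0 : Fin 4) (tripleProduct a b c) =
      E.s (1 : Fin 2) (E.s (0 : Fin 1) (E.d (0 : Fin 2) a) * b) * E.s (0 : Fin 2) c := by
  have h₂ (v : E _⦋2⦌) :
      E.d (0 : Fin 4) (E.s (2 : Fin 3) v) = E.s (1 : Fin 2) (E.d (0 : Fin 3) v) :=
    d_s_of_le (i := 0) (j := (1 : Fin 2)) (Fin.zero_le _) v
  have h₁ (v : E _⦋2⦌) :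
      E.d (0 : Fin 4) (E.s (1 : Fin 3) v) = E.s (0 : Fin 2) (E.d (0 : Fin 3) v) :=
    d_s_of_le (i := 0) (j := (0 : Fin 2)) (Fin.zero_le _) v
  rw [tripleProduct, map_mul, h₂, h₁, d_zero_s_zero, map_mul, d_zero_s_one, d_zero_s_zero]

theorem d_one_tripleProduct (a b c : E _⦋1⦌) :
    E.d (1 : Fin 4) (tripleProduct a b c) = E.s (1 : Fin 2) (a * b) * E.s (0 : Fin 2) c := by
  have h₂ (v : E _⦋2⦌) :
      E.d (1 : Fin 4) (E.s (2 : Fin 3) v) = E.s (1 : Fin 2) (E.d (1 : Fin 3) v) :=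
    d_s_of_le (i := 1) (j := (1 : Fin 2)) le_rfl v
  have h₁ (v : E _⦋2⦌) : E.d (1 : Fin 4) (E.s (1 : Fin 3) v) = v := d_s_self (1 : Fin 3) v
  rw [tripleProduct, map_mul, h₂, h₁, map_mul, d_one_s_one, d_one_s_zero]

theorem d_two_tripleProduct (a b c : E _⦋1⦌) :
    E.d (2 : Fin 4) (tripleProduct a b c) = E.s (1 : Fin 2) a * E.s (0 : Fin 2) (b * c) := by
  have h₂ (v : E _⦋2⦌) : E.d (2 : Fin 4) (E.s (2 : Fin 3) v) = v := d_s_self (2 : Fin 3) v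
  have h₁ (v : E _⦋2⦌) : E.d (2 : Fin 4) (E.s (1 : Fin 3) v) = v := d_s_succ (1 : Fin 3) v
  rw [tripleProduct, map_mul, h₂, h₁, map_mul, mul_assoc]

theorem d_three_tripleProduct (a b c : E _⦋1⦌) :
    E.d (3 : Fin 4) (tripleProduct a b c) =
      E.s (1 : Fin 2) a * E.s (0 : Fin 2) (E.s (0 : Fin 1) (E.d (1 : Fin 2) c) * b) := by
  have h₂ (v : E _⦋2⦌) : E.d (3 : Fin 4) (E.s (2 : Fin 3) v) = v := d_s_succ (2 : Fin 3) v
  have h₁ (v : E _⦋2⦌) :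
      E.d (3 : Fin 4) (E.s (1 : Fin 3) v) = E.s (1 : Fin 2) (E.d (2 : Fin 3) v) :=
    d_s_of_gt (i := 2) (j := (1 : Fin 2)) (by decide) v
  rw [tripleProduct, map_mul, h₂, h₁, d_two_s_zero, s_one_s_zero, mul_assoc, ← map_mul, mul_comm b]

end Faces

section Cocycle

variable {E : SimpAlg.{u, v} k}

theorem IsSkeletal.exists_cocycle (hE : E.IsSkeletal 1) :
    ∃ ρ : E _⦋2⦌ →+ (E.kerCM 1).Tensor (E.kerCM 0), ∀ a b : E _⦋1⦌,
      ρ (E.s (1 : Fin 2) a * E.s (0 : Fin 2) b) = -(kerProj 1 b ⊗ₜ[E _⦋1⦌] kerProj 0 a) := by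
  let β : E _⦋1⦌ →+ E _⦋1⦌ →+ (E.kerCM 1).Tensor (E.kerCM 0) :=
    .mk' (fun a => .mk' (fun b => -(kerProj 1 b ⊗ₜ[E _⦋1⦌] kerProj 0 a)) fun b b' => by
        rw [map_add, TensorProduct.add_tmul, neg_add])
      fun a a' => by
        ext b
        change -(kerProj 1 b ⊗ₜ[E _⦋1⦌] kerProj 0 (a + a')) =
          -(kerProj 1 b ⊗ₜ[E _⦋1⦌] kerProj 0 a) + -(kerProj 1 b ⊗ₜ[E _⦋1⦌] kerProj 0 a')
        rw [map_add, TensorProduct.tmul_add, neg_add]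
  refine exists_addMonoidHom_of_isPushout hE.isPushout_two β fun r a b => ?_
  change -(kerProj 1 b ⊗ₜ[E _⦋1⦌] kerProj 0 (E.s (0 : Fin 1) r * a)) =
    -(kerProj 1 (E.s (0 : Fin 1) r * b) ⊗ₜ[E _⦋1⦌] kerProj 0 a)
  rw [kerProj_s_mul, kerProj_s_mul, TensorProduct.smul_tmul]

/-- The additive map `E_2 → Ker d_1 ⊗ Ker d_0` that induces the inverse of `comparison`; under
`E_2 = E_1 ⊗ E_1` (over `E_0`) it is the normalized cocycle
`a ⊗ b ↦ -(b - s_0 d_1 b) ⊗ (a - s_0 d_0 a)`. -/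
noncomputable def IsSkeletal.cocycle (hE : E.IsSkeletal 1) :
    E _⦋2⦌ →+ (E.kerCM 1).Tensor (E.kerCM 0) :=
  hE.exists_cocycle.choose

theorem IsSkeletal.cocycle_s_mul_s (hE : E.IsSkeletal 1) (a b : E _⦋1⦌) :
    hE.cocycle (E.s (1 : Fin 2) a * E.s (0 : Fin 2) b) = -(kerProj 1 b ⊗ₜ kerProj 0 a) :=
  hE.exists_cocycle.choose_spec a b

theorem IsSkeletal.cocycle_alternating_sum (hE : E.IsSkeletal 1) (w : E _⦋3⦌) :
    hE.cocycle (E.d (0 : Fin 4) w) - hE.cocycle (E.d (1 : Fin 4) w) +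
      hE.cocycle (E.d (2 : Fin 4) w) - hE.cocycle (E.d (3 : Fin 4) w) = 0 := by
  induction w using hE.induction_three with
  | add w w' hw hw' => linear_combination (norm := (simp only [map_add]; abel)) hw + hw'
  | mul a b c =>
    simp only [d_zero_tripleProduct, d_one_tripleProduct, d_two_tripleProduct,
      d_three_tripleProduct, hE.cocycle_s_mul_s, kerProj_s_mul, kerProj_mul, mul_comm b c,
      TensorProduct.add_tmul, TensorProduct.tmul_add, TensorProduct.smul_tmul,
      TensorProduct.tmul_smul]
    abel

theorem IsSkeletal.cocycle_eq_zero_of_mem_boundaries (hE : E.IsSkeletal 1) {u : E.moore 2}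
    (hu : u ∈ E.boundaries 2) :
    hE.cocycle u = 0 := by
  obtain ⟨w, hw, hwu⟩ := hu
  have h_sum := hE.cocycle_alternating_sum w
  rw [show E.d (0 : Fin 4) w = 0 from mem_moore_three hw 0,
    show E.d (1 : Fin 4) w = 0 from mem_moore_three hw 1,
    show E.d (2 : Fin 4) w = 0 from mem_moore_three hw 2] at h_sum
  rw [← hwu]
  simpa using h_sum

theorem IsSkeletal.cocycle_pairing (hE : E.IsSkeletal 1) (x : E.kerD 0) (z : E.kerD 1) :
    hE.cocycle (pairing x (z : E _⦋1⦌)) = z ⊗ₜ x := by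
  have h : (pairing x (z : E _⦋1⦌) : E _⦋2⦌) =
      E.s (1 : Fin 2) (x * z) * E.s (0 : Fin 2) 1 - E.s (1 : Fin 2) x * E.s (0 : Fin 2) z := by
    rw [coe_pairing, map_one, map_mul]
    ring
  rw [h, map_sub, hE.cocycle_s_mul_s, hE.cocycle_s_mul_s, kerProj_one, kerProj_coe, kerProj_coe,
    TensorProduct.zero_tmul, neg_zero, zero_sub, neg_neg]

theorem IsSkeletal.comparison_cocycle (hE : E.IsSkeletal 1) (w : E _⦋2⦌) :
    E.comparison (hE.cocycle w) = TopCorner.mk E (moorePart w) := by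
  induction w using hE.induction_two with
  | add w w' hw hw' => simp only [map_add, hw, hw']
  | mul a b =>
    rw [hE.cocycle_s_mul_s, map_neg, comparison_tmul, moorePart_s_mul_s, map_neg]

theorem IsSkeletal.comparison_surjective (hE : E.IsSkeletal 1) :
    Function.Surjective E.comparison := by
  intro q
  obtain ⟨u, rfl⟩ := TopCorner.mk_surjective q
  exact ⟨hE.cocycle u, by rw [hE.comparison_cocycle, moorePart_coe]⟩

theorem IsSkeletal.exists_comparison_eq_mk (hE : E.IsSkeletal 1)
    (t : (E.kerCM 1).Tensor (E.kerCM 0)) :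
    ∃ u : E.moore 2, E.comparison t = TopCorner.mk E u ∧ hE.cocycle u = t := by
  induction t using TensorProduct.induction_on with
  | zero => exact ⟨0, by rw [map_zero, map_zero], by rw [Submodule.coe_zero, map_zero]⟩
  | tmul z x => exact ⟨pairing x z, comparison_tmul z x, hE.cocycle_pairing x z⟩
  | add t t' ht ht' =>
    obtain ⟨u, hu, rfl⟩ := ht
    obtain ⟨u', hu', rfl⟩ := ht'
    exact ⟨u + u', by rw [map_add, hu, hu', map_add], by rw [Submodule.coe_add, map_add]⟩

theorem IsSkeletal.comparison_injective (hE : E.IsSkeletal 1) :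
    Function.Injective E.comparison := by
  refine (injective_iff_map_eq_zero _).2 fun t ht => ?_
  obtain ⟨u, hu, rfl⟩ := hE.exists_comparison_eq_mk t
  exact hE.cocycle_eq_zero_of_mem_boundaries (TopCorner.mk_eq_zero.1 (hu.symm.trans ht))

/-- The comparison morphism of a `1`-skeletal simplicial algebra, as an isomorphism. -/
noncomputable def IsSkeletal.comparisonEquiv (hE : E.IsSkeletal 1) :
    (E.kerCM 1).Tensor (E.kerCM 0) ≃ₗ[E _⦋1⦌] E.TopCorner :=
  .ofBijective (E.comparison : (E.kerCM 1).Tensor (E.kerCM 0) →ₗ[E _⦋1⦌] E.TopCorner)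
    ⟨hE.comparison_injective, hE.comparison_surjective⟩

end Cocycle

end SimpAlg

namespace CrossedModule

variable {R M N : Type*} [CommRing R]
  [NonUnitalCommRing M] [Module R M] [IsScalarTower R M M] [SMulCommClass R M M]
  [NonUnitalCommRing N] [Module R N] [IsScalarTower R N N] [SMulCommClass R N N]
  (X : CrossedModule R M) (Y : CrossedModule R N)

theorem comm_mul (s t : X.Tensor Y) :
    TensorProduct.comm R M N (s * t) = TensorProduct.comm R M N s * TensorProduct.comm R M N t := by
  induction s using TensorProduct.induction_on with
  | zero => simp only [zero_mul, map_zero]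
  | add s s' hs hs' => simp only [add_mul, map_add, hs, hs']
  | tmul m n =>
    induction t using TensorProduct.induction_on with
    | zero => simp only [mul_zero, map_zero]
    | add t t' ht ht' => simp only [mul_add, map_add, ht, ht']
    | tmul m' n' => simp only [Algebra.TensorProduct.tmul_mul_tmul, TensorProduct.comm_tmul]

theorem tensorFst_comm (t : X.Tensor Y) :
    Y.tensorFst X (TensorProduct.comm R M N t) = X.tensorSnd Y t := by
  induction t using TensorProduct.induction_on with
  | zero => simp only [map_zero]
  | add t t' ht ht' => simp only [map_add, ht, ht']
  | tmul m n => rfl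

theorem tensorSnd_comm (t : X.Tensor Y) :
    Y.tensorSnd X (TensorProduct.comm R M N t) = X.tensorFst Y t := by
  induction t using TensorProduct.induction_on with
  | zero => simp only [map_zero]
  | add t t' ht ht' => simp only [map_add, ht, ht']
  | tmul m n => rfl

end CrossedModule

theorem corollary5p2_general {k : Type u} [CommRing k] {E : SimpAlg.{u, v} k}
    (hE : E.IsSkeletal 1) :
    ∃ (Φ : (E.kerCM 1).Tensor (E.kerCM 0) ≃ₗ[E _⦋1⦌] E.TopCorner)
      (Ψ : (E.kerCM 0).Tensor (E.kerCM 1) ≃ₗ[E _⦋1⦌] E.TopCorner),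
      (∀ a b, Φ (a * b) = Φ a * Φ b) ∧
      (∀ a b, Ψ (a * b) = Ψ a * Ψ b) ∧
      (∀ x y : E.kerD 0, Φ (E.bar y ⊗ₜ[E _⦋1⦌] x) = SimpAlg.TopCorner.mk E (E.hElt x y)) ∧
      (∀ x y : E.kerD 0, Ψ (x ⊗ₜ[E _⦋1⦌] E.bar y) = SimpAlg.TopCorner.mk E (E.hElt x y)) ∧
      (∀ a, E.topBd 1 (Φ a) = (E.kerCM 1).tensorFst (E.kerCM 0) a) ∧
      (∀ a, E.topBd 0 (Φ a) = (E.kerCM 1).tensorSnd (E.kerCM 0) a) ∧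
      (∀ a, E.topBd 0 (Ψ a) = (E.kerCM 0).tensorFst (E.kerCM 1) a) ∧
      (∀ a, E.topBd 1 (Ψ a) = (E.kerCM 0).tensorSnd (E.kerCM 1) a) := by
  let swap := TensorProduct.comm (E _⦋1⦌) (E.kerD 0) (E.kerD 1)
  refine ⟨hE.comparisonEquiv, swap ≪≫ₗ hE.comparisonEquiv, map_mul E.comparison,
    fun a b => ?_, SimpAlg.comparison_bar_tmul, SimpAlg.comparison_bar_tmul,
    SimpAlg.topBd_one_comparison, SimpAlg.topBd_zero_comparison, fun a => ?_, fun a => ?_⟩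
  · exact (congrArg E.comparison (CrossedModule.comm_mul _ _ a b)).trans (map_mul E.comparison _ _)
  · exact (SimpAlg.topBd_zero_comparison _).trans (CrossedModule.tensorSnd_comm _ _ a)
  · exact (SimpAlg.topBd_one_comparison _).trans (CrossedModule.tensorFst_comm _ _ a)

theorem corollary5p2 {k : Type u} [CommRing k] {F E : SimpAlg.{u, v} k} (hF : F.IsFree)
    (ι : E ⟶ F) (hι : SimpAlg.IsSkeleton 1 ι) :
    ∃ (Φ : (E.kerCM 1).Tensor (E.kerCM 0) ≃ₗ[E _⦋1⦌] E.TopCorner)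
      (Ψ : (E.kerCM 0).Tensor (E.kerCM 1) ≃ₗ[E _⦋1⦌] E.TopCorner),
      (∀ a b, Φ (a * b) = Φ a * Φ b) ∧
      (∀ a b, Ψ (a * b) = Ψ a * Ψ b) ∧
      (∀ x y : E.kerD 0, Φ (E.bar y ⊗ₜ[E _⦋1⦌] x) = SimpAlg.TopCorner.mk E (E.hElt x y)) ∧
      (∀ x y : E.kerD 0, Ψ (x ⊗ₜ[E _⦋1⦌] E.bar y) = SimpAlg.TopCorner.mk E (E.hElt x y)) ∧
      (∀ a, E.topBd 1 (Φ a) = (E.kerCM 1).tensorFst (E.kerCM 0) a) ∧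
      (∀ a, E.topBd 0 (Φ a) = (E.kerCM 1).tensorSnd (E.kerCM 0) a) ∧
      (∀ a, E.topBd 0 (Ψ a) = (E.kerCM 0).tensorFst (E.kerCM 1) a) ∧
      (∀ a, E.topBd 1 (Ψ a) = (E.kerCM 0).tensorSnd (E.kerCM 1) a) :=
  corollary5p2_general hι.skeletal
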